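/- Let $\mathcal H$ be a real Hilbert space and let $A,B\colon\mathcal H\to 2^{\mathcal H}$ be maximally monotone operators. Let $$\boldsymbol Z=\{(x,u)\in\mathcal H\times\mathcal H \mid 0\in Ax+u,\ 0\in B^{-1}u-x\}$$ be the set of solutions of the primal-dual inclusion (with $L=\mathrm{Id}$), and assume $\boldsymbol Z\neq\varnothing$. Let $\Upsilon\colon\mathcal H\to\mathcal H$ be a strongly monotone self-adjoint bounded linear operator. Denote by $J_C=(\mathrm{Id}+C)^{-1}$ the resolvent of a set-valued operator $C$, and set $$G_{\Upsilon,B,A}=J_{\Upsilon B}\circ(2J_{\Upsilon A}-\mathrm{Id})+(\mathrm{Id}-J_{\Upsilon A}).$$ Let $(\lambda_n)_{n\in\mathbb N}$ be a sequence in $[0,2]$ with $\sum_{n\in\mathbb N}\lambda_n(2-\lambda_n)=+\infty$, let $(x_0,u_0)\in\mathcal H\times\mathcal H$, and for every $n\in\mathbb N$ let $$p_{n+1}=J_{\Upsilon A}(x_n-\Upsilon u_n),\qquad q_{n+1}=J_{\Upsilon^{-1}B^{-1}}\big(u_n+\Upsilon^{-1}(2p_{n+1}-x_n)\big),$$ $$(x_{n+1},u_{n+1})=(1-\lambda_n)(x_n,u_n)+\lambda_n(p_{n+1},q_{n+1}).$$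 Set $z_n=x_n-\Upsilon u_n$ for every $n\in\mathbb N$. Then the following hold. 1. $\Upsilon$ is invertible with bounded inverse, and $J_{\Upsilon A}$, $J_{\Upsilon B}$ and $J_{\Upsilon^{-1}B^{-1}}$ are single-valued and defined on all of $\mathcal H$, so that the objects above are well defined. 2. For every $n\in\mathbb N$, $z_{n+1}=(1-\lambda_n)z_n+\lambda_n G_{\Upsilon,B,A}z_n$. 3. $(z_n)_{n\in\mathbb N}$ converges weakly in $\mathcal H$ to some $\hat z\in\operatorname{Fix}G_{\Upsilon,B,A}$, and $\big(J_{\Upsilon A}\hat z,\,-\Upsilon^{-1}(\hat z-J_{\Upsilon A}\hat z)\big)\in\boldsymbol Z$. -/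

import Mathlib

open Filter Topology
open scoped Pointwise

/-! Set-valued operators `A : E → 2^F` are functions `A : E → Set F`. -/

namespace SetValuedOp

section Basic

variable {E F : Type*}

/-- The inverse `A⁻¹ : u ↦ {x | u ∈ A x}` of a set-valued operator. -/
def inv (A : E → Set F) : F → Set E := fun u => {x | u ∈ A x}

/-- The composition `T A : x ↦ {T a | a ∈ A x}` of a set-valued operator with a single-valued one. -/
def comp {K : Type*} (T : F → K) (A : E → Set F) : E → Set K := fun x => T '' A x

end Basic

section Hilbert

variable {H : Type*} [NormedAddCommGroup H] [InnerProductSpace ℝ H]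

/-- `A` is monotone: `⟨x - y, u - v⟩ ≥ 0` for all `(x, u)`, `(y, v)` in the graph of `A`. -/
def IsMonotone (A : H → Set H) : Prop :=
  ∀ x u y v : H, u ∈ A x → v ∈ A y → 0 ≤ inner ℝ (x - y) (u - v)

/-- `A` is maximally monotone: it is monotone, and each `(x, u)` that is monotonically related to
the graph of `A` belongs to the graph of `A`. -/
def IsMaximallyMonotone (A : H → Set H) : Prop :=
  IsMonotone A ∧
    ∀ x u : H, (∀ y v : H, v ∈ A y → 0 ≤ inner ℝ (x - y) (u - v)) → u ∈ A x

/-- `T` is strongly monotone: for some `β > 0`, `⟨x - y, T x - T y⟩ ≥ β ‖x - y‖²` everywhere. -/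
def IsStronglyMonotone (T : H → H) : Prop :=
  ∃ β : ℝ, 0 < β ∧ ∀ x y : H, β * ‖x - y‖ ^ 2 ≤ inner ℝ (x - y) (T x - T y)

/-- The resolvent `(Id + A)⁻¹` of `A`, as a set-valued operator. -/
def setResolvent (A : H → Set H) : H → Set H := inv fun p => {p} + A p

/-- The resolvent `J_A` of `A`, as a single-valued operator: `J A x` is the element of
`(Id + A)⁻¹ x`. It is meaningful where `(Id + A)⁻¹ x` is a singleton, see `HasResolvent`. -/
noncomputable def J (A : H → Set H) (x : H) : H :=
  Classical.epsilon fun p => p ∈ setResolvent A x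

/-- The resolvent `(Id + A)⁻¹` is single-valued and defined on the whole space. -/
def HasResolvent (A : H → Set H) : Prop := ∀ x : H, setResolvent A x = {J A x}

/-- The Douglas--Rachford operator
`G_{Υ,B,A} = J_{ΥB} ∘ (2 J_{ΥA} - Id) + (Id - J_{ΥA})`. -/
noncomputable def douglasRachford (Υ : H →L[ℝ] H) (B A : H → Set H) : H → H := fun z =>
  J (comp Υ B) ((2 : ℝ) • J (comp Υ A) z - z) + (z - J (comp Υ A) z)

variable {G : Type*} [NormedAddCommGroup G] [InnerProductSpace ℝ G]
  [CompleteSpace H] [CompleteSpace G]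

/-- The set of solutions of the primal-dual inclusion: all `(x, u)` with `0 ∈ A x + L* u` and
`0 ∈ B⁻¹ u - L x`. -/
def primalDualSolutions (A : H → Set H) (B : G → Set G) (L : H →L[ℝ] G) : Set (H × G) :=
  {w | (0 : H) ∈ A w.1 + {ContinuousLinearMap.adjoint L w.2} ∧ (0 : G) ∈ inv B w.2 - {L w.1}}

end Hilbert

end SetValuedOp

/-! The substitution `z = x - Υ u` turns the primal-dual iteration into a relaxed Douglas–Rachford
iteration. With `w = 2p - z`, Moreau's decomposition (`J_comp_symm_inv`) gives `Υ q = w - J_{ΥB} w`,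
so `p - Υ q = G z`.

In the metric `⟨Υ⁻¹ ·, ·⟩` the displacement `D = Id - G` is firmly nonexpansive: add the
monotonicity inequalities of `A` and `B` at the resolvent points. A solution `(a, b)` makes `a - Υ
b` a zero of `D`, so the Krasnosel'skiĭ–Mann argument (Fejér monotonicity, vanishing residuals,
demiclosedness, Opial) yields a weak limit, and unfolding its fixed-point equation gives the
solution pair.

Well-definedness rests on Lax–Milgram for `Υ⁻¹` and on Minty's theorem for the resolvents, the
latter obtained by minimizing the Fitzpatrick function plus a quadratic. -/

namespace SetValuedOp

/-! ### Minimizing a linear plus a quadratic form over a convex set -/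

section Minimization

variable {E : Type*} [NormedAddCommGroup E] [NormedSpace ℝ E]

/-- A minimizer over a convex set of the sum of a linear form and half a quadratic form satisfies
the corresponding variational inequality. -/
theorem variational_inequality_of_isMinOn (B : E →L[ℝ] E →L[ℝ] ℝ) (hB : ∀ v w, B v w = B w v)
    {C : Set (E × ℝ)} (hC : Convex ℝ C) {w : E × ℝ} (hw : w ∈ C)
    (hmin : ∀ v ∈ C, w.2 + B w.1 w.1 / 2 ≤ v.2 + B v.1 v.1 / 2) {v : E × ℝ} (hv : v ∈ C) :
    w.2 + B w.1 w.1 ≤ v.2 + B w.1 v.1 := by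
  -- Minimality against `w + s (v - w)`, divided by `s`; the claim is the limit `s → 0`.
  have key : ∀ s ∈ Set.Ioc (0 : ℝ) 1,
      0 ≤ (v.2 - w.2 + B w.1 (v.1 - w.1)) + s * (B (v.1 - w.1) (v.1 - w.1) / 2) := by
    intro s hs
    have h := hmin _ (hC.add_smul_sub_mem hw hv ⟨hs.1.le, hs.2⟩)
    simp only [Prod.snd_add, Prod.fst_add, Prod.smul_snd, Prod.smul_fst, Prod.snd_sub,
      Prod.fst_sub, smul_eq_mul, map_add, map_smul, add_apply,
      smul_apply] at h
    rw [hB (v.1 - w.1) w.1] at h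
    refine nonneg_of_mul_nonneg_right ?_ hs.1
    linarith
  have hlim : Tendsto (fun s : ℝ => (v.2 - w.2 + B w.1 (v.1 - w.1)) +
      s * (B (v.1 - w.1) (v.1 - w.1) / 2)) (𝓝[>] 0) (𝓝 ((v.2 - w.2 + B w.1 (v.1 - w.1)) +
      0 * (B (v.1 - w.1) (v.1 - w.1) / 2))) := by
    refine Tendsto.mono_left (Continuous.tendsto (by fun_prop) _) nhdsWithin_le_nhds
  have h0 := ge_of_tendsto hlim
    (eventually_of_mem (Ioc_mem_nhdsGT (zero_lt_one' ℝ)) fun s hs => key s hs)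
  rw [map_sub] at h0
  linarith

/-- The sum of a linear form and half a coercive quadratic form attains its infimum over a
nonempty closed convex set on which it is bounded below. -/
theorem exists_isMinOn_of_isCoercive [CompleteSpace E] (B : E →L[ℝ] E →L[ℝ] ℝ)
    (hB : ∀ v w, B v w = B w v) (hco : IsCoercive B)
    {C : Set (E × ℝ)} (hC : Convex ℝ C) (hcl : IsClosed C) (hne : C.Nonempty)
    (hbd : ∃ m : ℝ, ∀ v ∈ C, m ≤ v.2 + B v.1 v.1 / 2) :
    ∃ w ∈ C, ∀ v ∈ C, w.2 + B w.1 w.1 / 2 ≤ v.2 + B v.1 v.1 / 2 := by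
  obtain ⟨c, hc, hco⟩ := hco
  set φ : E × ℝ → ℝ := fun v => v.2 + B v.1 v.1 / 2 with hφ
  obtain ⟨m₀, hm₀⟩ := hbd
  have hbdd : BddBelow (φ '' C) := ⟨m₀, by rintro _ ⟨v, hv, rfl⟩; exact hm₀ v hv⟩
  set m := sInf (φ '' C) with hm
  have hle : ∀ v ∈ C, m ≤ φ v := fun v hv => csInf_le hbdd ⟨v, hv, rfl⟩
  have hex : ∀ n : ℕ, ∃ v ∈ C, φ v < m + 1 / ((n : ℝ) + 1) := by
    intro n
    obtain ⟨_, ⟨v, hv, rfl⟩, h⟩ := exists_lt_of_csInf_lt (hne.image φ)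
      (lt_add_of_pos_right m (Nat.one_div_pos_of_nat (α := ℝ) (n := n)))
    exact ⟨v, hv, h⟩
  choose v hvC hv using hex
  -- Parallelogram identity at the midpoint. It controls only the `E`-component of a minimizing
  -- sequence; the real component converges afterwards because `φ (v n)` does.
  have hpar : ∀ a ∈ C, ∀ b ∈ C,
      c * ‖a.1 - b.1‖ * ‖a.1 - b.1‖ ≤ 4 * ((φ a - m) + (φ b - m)) := by
    intro a ha b hb
    have h1 := hle _ (hC ha hb (by norm_num : (0 : ℝ) ≤ 1 / 2) (by norm_num : (0 : ℝ) ≤ 1 / 2)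
      (by norm_num))
    have h2 := hco (a.1 - b.1)
    simp only [hφ, Prod.snd_add, Prod.fst_add, Prod.smul_snd, Prod.smul_fst,
      smul_eq_mul, map_add, map_smul, map_sub, add_apply,
      smul_apply, sub_apply] at h1 h2 ⊢
    rw [hB b.1 a.1] at h1 h2
    linarith
  have hzero : Tendsto (fun n : ℕ => 1 / ((n : ℝ) + 1)) atTop (𝓝 0) :=
    tendsto_one_div_add_atTop_nhds_zero_nat
  have hcau : CauchySeq fun n => (v n).1 := by
    refine cauchySeq_of_le_tendsto_0' (fun n : ℕ => √(8 / c * (1 / ((n : ℝ) + 1)))) ?_ ?_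
    · intro n k hnk
      rw [dist_eq_norm]
      refine Real.le_sqrt_of_sq_le ?_
      have h1 := hpar _ (hvC n) _ (hvC k)
      have h2 := hv n
      have h3 := hv k
      have h4 : 1 / ((k : ℝ) + 1) ≤ 1 / ((n : ℝ) + 1) := by
        gcongr
      have h5 : c * ‖(v n).1 - (v k).1‖ ^ 2 ≤ 8 * (1 / ((n : ℝ) + 1)) := by nlinarith
      rw [div_mul_eq_mul_div, le_div_iff₀ hc]
      linarith
    · have := (hzero.const_mul (8 / c)).sqrt
      simpa using this
  obtain ⟨w, hw⟩ := cauchySeq_tendsto_of_complete hcau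
  have hφlim : Tendsto (fun n => φ (v n)) atTop (𝓝 m) := by
    refine tendsto_of_tendsto_of_tendsto_of_le_of_le tendsto_const_nhds
      (by simpa using hzero.const_add m) (fun n => hle _ (hvC n)) fun n => (hv n).le
  have hBlim : Tendsto (fun n => B (v n).1 (v n).1) atTop (𝓝 (B w w)) :=
    Continuous.tendsto (f := fun x : E => B x x) (by fun_prop) w |>.comp hw
  have htlim : Tendsto (fun n => (v n).2) atTop (𝓝 (m - B w w / 2)) := by
    refine (hφlim.sub (hBlim.div_const 2)).congr fun n => ?_
    simp [hφ]
  refine ⟨(w, m - B w w / 2), hcl.mem_of_tendsto (hw.prodMk_nhds htlim)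
    (Eventually.of_forall hvC), fun a ha => ?_⟩
  simpa using hle a ha

end Minimization

/-! ### Weak convergence of relaxed fixed-point iterations -/

section KrasnoselskiiMann

variable {H : Type*} [NormedAddCommGroup H] [InnerProductSpace ℝ H]

/-- Along an ultrafilter, a bounded family in a Hilbert space converges weakly. -/
theorem exists_tendsto_inner_of_bounded [CompleteSpace H] {ι : Type*} (U : Ultrafilter ι)
    {z : ι → H} {r : ℝ} (hz : ∀ i, ‖z i‖ ≤ r) :
    ∃ w : H, ∀ y : H, Tendsto (fun i => inner ℝ (z i) y) U (𝓝 (inner ℝ w y)) := by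
  -- Banach–Alaoglu, transported through the Riesz isomorphism.
  let f : ι → WeakDual ℝ H := fun i => StrongDual.toWeakDual (InnerProductSpace.toDual ℝ H (z i))
  have hK := WeakDual.isCompact_closedBall (𝕜 := ℝ) (E := H) 0 r
  obtain ⟨φ, -, hφ⟩ := hK.ultrafilter_le_nhds (U.map f) (by
    rw [le_principal_iff]
    refine mem_map.2 (univ_mem' fun i => ?_)
    have : ‖InnerProductSpace.toDual ℝ H (z i)‖ ≤ r := by simpa using hz i
    simpa [f] using this)
  refine ⟨(InnerProductSpace.toDual ℝ H).symm (WeakDual.toStrongDual φ), fun y => ?_⟩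
  have h := ((WeakDual.eval_continuous y).tendsto φ).comp (show Tendsto f U (𝓝 φ) from hφ)
  simpa [f, Function.comp_def] using h

/-- Weak convergence in a Hilbert space is convergence of inner products. -/
theorem tendsto_toWeakSpace_of_tendsto_inner [CompleteSpace H] {ι : Type*} {l : Filter ι}
    {z : ι → H} {w : H} (h : ∀ y : H, Tendsto (fun i => inner ℝ (z i) y) l (𝓝 (inner ℝ w y))) :
    Tendsto (fun i => toWeakSpace ℝ H (z i)) l (𝓝 (toWeakSpace ℝ H w)) := by
  refine (WeakBilin.tendsto_iff_forall_eval_tendsto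
    (B := (topDualPairing ℝ H).flip) ?_).2 fun y => ?_
  · intro a b hab
    by_contra hne
    obtain ⟨g, hg⟩ := SeparatingDual.exists_separating_of_ne (R := ℝ) hne
    exact hg (LinearMap.congr_fun hab g)
  · have := h ((InnerProductSpace.toDual ℝ H).symm y)
    simp_rw [real_inner_comm ((InnerProductSpace.toDual ℝ H).symm y),
      InnerProductSpace.toDual_symm_apply] at this
    exact this

/-- The relaxed Krasnosel'skiĭ--Mann theorem for an operator whose displacement `D` is firmly
nonexpansive with respect to the inner product `⟨M ·, ·⟩`. -/
theorem exists_weak_limit_of_firmlyNonexpansive [CompleteSpace H] (M : H →L[ℝ] H)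
    (hM : ∀ x y, inner ℝ (M x) y = inner ℝ x (M y)) {c : ℝ} (hc : 0 < c)
    (hco : ∀ x, c * ‖x‖ ^ 2 ≤ inner ℝ (M x) x) (D : H → H)
    (hD : ∀ x y, inner ℝ (M (D x - D y)) (D x - D y) ≤ inner ℝ (M (D x - D y)) (x - y))
    (hfix : ∃ y, D y = 0) {lam : ℕ → ℝ} (hlam : ∀ n, lam n ∈ Set.Icc (0 : ℝ) 2)
    (hsum : Tendsto (fun N => ∑ n ∈ Finset.range N, lam n * (2 - lam n)) atTop atTop)
    {z : ℕ → H} (hz : ∀ n, z (n + 1) = z n - lam n • D (z n)) :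
    ∃ w, D w = 0 ∧ ∀ y : H, Tendsto (fun n => inner ℝ (z n) y) atTop (𝓝 (inner ℝ w y)) := by
  have hsymm : ∀ x y, inner ℝ (M x) y = inner ℝ (M y) x := fun x y => by
    rw [hM, real_inner_comm]
  have hnn : ∀ x, 0 ≤ inner ℝ (M x) x := fun x => le_trans (by positivity) (hco x)
  -- Fejér monotonicity
  have hfej : ∀ y, D y = 0 → ∀ n, inner ℝ (M (z (n + 1) - y)) (z (n + 1) - y) +
      lam n * (2 - lam n) * inner ℝ (M (D (z n))) (D (z n)) ≤
        inner ℝ (M (z n - y)) (z n - y) := by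
    intro y hy n
    have h1 := hD (z n) y
    rw [hy, sub_zero] at h1
    have h2 : z (n + 1) - y = (z n - y) - lam n • D (z n) := by rw [hz]; abel
    rw [h2]
    simp only [map_sub M (z n - y) (lam n • D (z n)), map_smul, inner_sub_left,
      inner_sub_right (𝕜 := ℝ) _ (z n - y) (lam n • D (z n)), inner_smul_left, inner_smul_right,
      RCLike.conj_to_real]
    rw [hsymm (z n - y) (D (z n))]
    nlinarith [mul_le_mul_of_nonneg_left h1 (hlam n).1]
  have hanti : ∀ y, D y = 0 → Antitone fun n => inner ℝ (M (z n - y)) (z n - y) := by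
    refine fun y hy => antitone_nat_of_succ_le fun n => ?_
    have := hfej y hy n
    have h2 : 0 ≤ lam n * (2 - lam n) * inner ℝ (M (D (z n))) (D (z n)) :=
      mul_nonneg (mul_nonneg (hlam n).1 (sub_nonneg.2 (hlam n).2)) (hnn _)
    linarith
  -- the residuals decrease
  have hres : Antitone fun n => inner ℝ (M (D (z n))) (D (z n)) := by
    refine antitone_nat_of_succ_le fun n => ?_
    -- The estimate below bounds `λ` times the increase of the residual by `-(2 - λ)` times the
    -- squared norm of the difference of successive displacements, so `λ` must be positive to be
    -- cancelled.
    rcases (hlam n).1.eq_or_lt with h0 | h0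
    · rw [hz, ← h0, zero_smul, sub_zero]
    have h1 := hD (z (n + 1)) (z n)
    have h2 : z (n + 1) - z n = -(lam n • D (z n)) := by rw [hz]; abel
    have h3 := hnn (D (z (n + 1)) - D (z n))
    rw [h2] at h1
    simp only [map_sub, inner_sub_left, inner_sub_right, inner_smul_right, inner_neg_right]
      at h1 h3
    rw [hsymm (D (z n)) (D (z (n + 1)))] at h1 h3
    have h4 := mul_nonneg (sub_nonneg.2 (hlam n).2) h3
    nlinarith
  obtain ⟨y₀, hy₀⟩ := hfix
  have htot : ∀ N, inner ℝ (M (z N - y₀)) (z N - y₀) +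
      ∑ n ∈ Finset.range N, lam n * (2 - lam n) * inner ℝ (M (D (z n))) (D (z n)) ≤
        inner ℝ (M (z 0 - y₀)) (z 0 - y₀) := by
    intro N
    induction N with
    | zero => simp
    | succ N ih =>
      rw [Finset.sum_range_succ]
      linarith [hfej y₀ hy₀ N]
  -- Residuals decrease, so the last one may replace every residual in the telescoped sum;
  -- divergence of the weights then forces it to zero.
  have hbound : ∀ N, (∑ n ∈ Finset.range N, lam n * (2 - lam n)) *
      inner ℝ (M (D (z N))) (D (z N)) ≤ inner ℝ (M (z 0 - y₀)) (z 0 - y₀) := by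
    intro N
    have h1 : (∑ n ∈ Finset.range N, lam n * (2 - lam n)) * inner ℝ (M (D (z N))) (D (z N)) ≤
        ∑ n ∈ Finset.range N, lam n * (2 - lam n) * inner ℝ (M (D (z n))) (D (z n)) := by
      rw [Finset.sum_mul]
      refine Finset.sum_le_sum fun n hn => mul_le_mul_of_nonneg_left
        (hres (Finset.mem_range.1 hn).le)
        (mul_nonneg (hlam n).1 (sub_nonneg.2 (hlam n).2))
    linarith [htot N, hnn (z N - y₀)]
  have hres0 : Tendsto (fun n => inner ℝ (M (D (z n))) (D (z n))) atTop (𝓝 0) := by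
    refine squeeze_zero' (Eventually.of_forall fun n => hnn _) ?_
      (hsum.const_div_atTop (inner ℝ (M (z 0 - y₀)) (z 0 - y₀)))
    filter_upwards [hsum.eventually_gt_atTop 0] with N hN
    rw [le_div_iff₀ hN, mul_comm]
    exact hbound N
  have hD0 : Tendsto (fun n => D (z n)) atTop (𝓝 0) := by
    rw [tendsto_zero_iff_norm_tendsto_zero]
    have h := (hres0.div_const c).sqrt
    simp only [zero_div, Real.sqrt_zero] at h
    refine squeeze_zero (fun n => norm_nonneg _) (fun n => Real.le_sqrt_of_sq_le ?_) h
    rw [le_div_iff₀ hc, mul_comm]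
    exact hco _
  obtain ⟨r, hr⟩ : ∃ r, ∀ n, ‖z n‖ ≤ r := by
    refine ⟨√(inner ℝ (M (z 0 - y₀)) (z 0 - y₀) / c) + ‖y₀‖, fun n => ?_⟩
    have h1 : ‖z n - y₀‖ ≤ √(inner ℝ (M (z 0 - y₀)) (z 0 - y₀) / c) := by
      refine Real.le_sqrt_of_sq_le ?_
      rw [le_div_iff₀ hc, mul_comm]
      exact (hco _).trans (hanti y₀ hy₀ (Nat.zero_le n))
    linarith [norm_le_norm_sub_add (z n) y₀]
  -- weak cluster points are zeros of `D`
  have hdemi : ∀ U : Ultrafilter ℕ, (U : Filter ℕ) ≤ atTop → ∀ w,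
      (∀ y, Tendsto (fun n => inner ℝ (z n) y) U (𝓝 (inner ℝ w y))) → D w = 0 := by
    intro U hU w hw
    have hDU : Tendsto (fun n => D (z n) - D w) U (𝓝 (0 - D w)) :=
      (hD0.mono_left hU).sub_const _
    have hl : Tendsto (fun n => inner ℝ (M (D (z n) - D w)) (D (z n) - D w)) U
        (𝓝 (inner ℝ (M (0 - D w)) (0 - D w))) :=
      ((M.continuous.tendsto _).comp hDU).inner hDU
    have hr1 : Tendsto (fun n => inner ℝ (M (D (z n))) (z n - w)) U (𝓝 0) := by
      have h1 : Tendsto (fun n => ‖M (D (z n))‖ * (r + ‖w‖)) U (𝓝 0) := by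
        have := ((M.continuous.norm.tendsto 0).comp (hD0.mono_left hU)).mul_const (r + ‖w‖)
        simpa using this
      refine squeeze_zero_norm (fun n => ?_) h1
      refine (norm_inner_le_norm _ _).trans ?_
      gcongr
      exact (norm_sub_le _ _).trans (by linarith [hr n])
    have hr2 : Tendsto (fun n => inner ℝ (M (D w)) (z n - w)) U (𝓝 0) := by
      have := (hw (M (D w))).sub_const (inner ℝ w (M (D w)))
      rw [sub_self] at this
      refine this.congr fun n => ?_
      rw [← inner_sub_left, real_inner_comm]
    have hr3 : Tendsto (fun n => inner ℝ (M (D (z n) - D w)) (z n - w)) U (𝓝 0) := by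
      have := hr1.sub hr2
      rw [sub_zero] at this
      refine this.congr fun n => ?_
      rw [map_sub, inner_sub_left]
    -- Firm nonexpansiveness passes to the limit: the left side tends to the squared norm of `D w`,
    -- the right side to `0`.
    have h := le_of_tendsto_of_tendsto' hl hr3 fun n => hD _ _
    have h2 := hco (0 - D w)
    have h3 : ‖0 - D w‖ ^ 2 = 0 :=
      le_antisymm (nonpos_of_mul_nonpos_right (h2.trans h) hc) (by positivity)
    simpa using h3
  -- Opial's argument
  have huniq : ∀ U V : Ultrafilter ℕ, (U : Filter ℕ) ≤ atTop → (V : Filter ℕ) ≤ atTop →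
      ∀ w v, (∀ y, Tendsto (fun n => inner ℝ (z n) y) U (𝓝 (inner ℝ w y))) →
      (∀ y, Tendsto (fun n => inner ℝ (z n) y) V (𝓝 (inner ℝ v y))) → w = v := by
    intro U V hU hV w v hw hv
    have hconv : ∀ y, D y = 0 →
        ∃ l, Tendsto (fun n => inner ℝ (M (z n - y)) (z n - y)) atTop (𝓝 l) := fun y hy =>
      ⟨_, tendsto_atTop_ciInf (hanti y hy) ⟨0, by rintro _ ⟨n, rfl⟩; exact hnn _⟩⟩
    obtain ⟨l₁, h₁⟩ := hconv w (hdemi U hU w hw)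
    obtain ⟨l₂, h₂⟩ := hconv v (hdemi V hV v hv)
    -- The difference of the squared distances to `v` and `w` is affine in `z n`, so this pairing
    -- converges along the whole sequence and cannot distinguish the two cluster points.
    obtain ⟨l, hl⟩ : ∃ l, Tendsto (fun n => inner ℝ (z n) (M (w - v))) atTop (𝓝 l) := by
      refine ⟨_, (((h₂.sub h₁).sub_const (inner ℝ (M v) v - inner ℝ (M w) w)).div_const 2).congr
        fun n => ?_⟩
      simp only [map_sub, inner_sub_left, inner_sub_right, ← hM]
      rw [hsymm v (z n), hsymm w (z n)]
      ring
    have e₁ := tendsto_nhds_unique (hw (M (w - v))) (hl.mono_left hU)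
    have e₂ := tendsto_nhds_unique (hv (M (w - v))) (hl.mono_left hV)
    have h := hco (w - v)
    rw [hM, inner_sub_left, e₁, e₂, sub_self] at h
    have h3 : ‖w - v‖ ^ 2 = 0 := le_antisymm (nonpos_of_mul_nonpos_right h hc) (by positivity)
    exact sub_eq_zero.1 (by simpa using h3)
  obtain ⟨w, hw⟩ := exists_tendsto_inner_of_bounded (Ultrafilter.of atTop) hr
  refine ⟨w, hdemi _ (Ultrafilter.of_le _) w hw, fun y => ?_⟩
  rw [tendsto_iff_ultrafilter]
  intro V hV
  obtain ⟨v, hv⟩ := exists_tendsto_inner_of_bounded V hr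
  rw [huniq _ V (Ultrafilter.of_le _) hV w v hw hv]
  exact hv y

end KrasnoselskiiMann

/-! ### Fitzpatrick functions, Minty's theorem and resolvents -/

section Resolvent

theorem mem_setResolvent {H : Type*} [NormedAddCommGroup H] {A : H → Set H} {x p : H} :
    p ∈ setResolvent A x ↔ x - p ∈ A p := by
  simp [setResolvent, inv, sub_eq_neg_add]

variable {H : Type*} [NormedAddCommGroup H] [InnerProductSpace ℝ H]

theorem IsMaximallyMonotone.inv {A : H → Set H} (hA : IsMaximallyMonotone A) :
    IsMaximallyMonotone (inv A) := by
  refine ⟨fun x u y v hu hv => ?_, fun x u h => hA.2 u x fun y v hv => ?_⟩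
  · rw [real_inner_comm]
    exact hA.1 u x v y hu hv
  · rw [real_inner_comm]
    exact h v y hv

/-- This shift reduces the resolvent equation at an arbitrary point to finding a zero. -/
theorem IsMaximallyMonotone.sub_const {A : H → Set H} (hA : IsMaximallyMonotone A) (w : H) :
    IsMaximallyMonotone fun x => {u | u + w ∈ A x} := by
  refine ⟨fun x u y v hu hv => ?_, fun x u h => hA.2 x (u + w) fun y v hv => ?_⟩
  · simpa using hA.1 x _ y _ hu hv
  · have := h y (v - w) (by simpa using hv)
    rwa [sub_sub_eq_add_sub] at this

/-- If the graph were empty, every pair would vacuously be monotonically related to it. -/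
theorem IsMaximallyMonotone.exists_mem {A : H → Set H} (hA : IsMaximallyMonotone A) :
    ∃ x u, u ∈ A x := by
  by_contra! h
  exact h 0 0 (hA.2 0 0 fun y v hv => absurd hv (h y v))

/-- The epigraph of the Fitzpatrick function of a set-valued operator. -/
def fitzpatrickEpigraph (A : H → Set H) : Set ((H × H) × ℝ) :=
  {w | ∀ y v, v ∈ A y → inner ℝ w.1.1 v + inner ℝ y w.1.2 - inner ℝ y v ≤ w.2}

theorem isClosed_fitzpatrickEpigraph (A : H → Set H) : IsClosed (fitzpatrickEpigraph A) := by
  simp only [fitzpatrickEpigraph, Set.ofPred_forall]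
  refine isClosed_iInter fun y => isClosed_iInter fun v => isClosed_iInter fun _ => ?_
  exact isClosed_le (by fun_prop) (by fun_prop)

theorem convex_fitzpatrickEpigraph (A : H → Set H) : Convex ℝ (fitzpatrickEpigraph A) := by
  intro a ha b hb s t hs ht hst y v hv
  have h1 := mul_le_mul_of_nonneg_left (ha y v hv) hs
  have h2 := mul_le_mul_of_nonneg_left (hb y v hv) ht
  simp only [Prod.fst_add, Prod.snd_add, Prod.smul_fst, Prod.smul_snd, inner_add_left,
    inner_add_right, inner_smul_left, inner_smul_right, RCLike.conj_to_real, smul_eq_mul]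
  linear_combination h1 + h2 + inner ℝ y v * hst

/-- Supplies the test points for the variational inequality in Minty's theorem. -/
theorem IsMonotone.mem_fitzpatrickEpigraph {A : H → Set H} (hA : IsMonotone A) {x u : H}
    (hu : u ∈ A x) : ((x, u), inner ℝ x u) ∈ fitzpatrickEpigraph A := by
  intro y v hv
  have := hA x u y v hu hv
  simp only [inner_sub_left, inner_sub_right] at this
  simp only
  linarith

/-- The Fitzpatrick function of a maximally monotone operator dominates the duality pairing. -/
theorem IsMaximallyMonotone.inner_le_of_mem_fitzpatrickEpigraph {A : H → Set H}
    (hA : IsMaximallyMonotone A) {w : (H × H) × ℝ} (hw : w ∈ fitzpatrickEpigraph A) :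
    inner ℝ w.1.1 w.1.2 ≤ w.2 := by
  by_contra! hlt
  have hmem : w.1.2 ∈ A w.1.1 := by
    refine hA.2 _ _ fun y v hv => ?_
    have := hw y v hv
    simp only [inner_sub_left, inner_sub_right]
    linarith
  -- Testing the epigraph inequality with the point itself contradicts `hlt`.
  have := hw _ _ hmem
  linarith

/-- The inverse of a coercive continuous linear equivalence is coercive. -/
theorem exists_coercive_symm (S : H ≃L[ℝ] H) {c : ℝ} (hc : 0 < c)
    (hco : ∀ x, c * ‖x‖ ^ 2 ≤ inner ℝ (S x) x) :
    ∃ d, 0 < d ∧ ∀ x, d * ‖x‖ ^ 2 ≤ inner ℝ (S.symm x) x := by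
  obtain ⟨K, hK, hle⟩ := (S : H →L[ℝ] H).bound
  -- Combines coercivity of `S` at `S⁻¹ x` with `‖x‖ ≤ K ‖S⁻¹ x‖`.
  refine ⟨c / K ^ 2, by positivity, fun x => ?_⟩
  have h1 := hle (S.symm x)
  simp only [ContinuousLinearEquiv.coe_coe, ContinuousLinearEquiv.apply_symm_apply] at h1
  have h2 := hco (S.symm x)
  rw [ContinuousLinearEquiv.apply_symm_apply, real_inner_comm] at h2
  refine le_trans ?_ h2
  rw [div_mul_eq_mul_div, div_le_iff₀ (by positivity), mul_assoc, ← mul_pow,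
    mul_comm ‖S.symm x‖ K]
  gcongr

theorem symm_apply_inner (S : H ≃L[ℝ] H) (hS : ∀ x y, inner ℝ (S x) y = inner ℝ x (S y))
    (x y : H) : inner ℝ (S.symm x) y = inner ℝ x (S.symm y) := by
  have := hS (S.symm x) (S.symm y)
  simpa using this.symm

variable [CompleteSpace H]

/-- **Minty's theorem** for a coercive self-adjoint metric: the Fitzpatrick function plus half the
metric's quadratic form attains its minimum at a zero of `M + A`. -/
theorem IsMaximallyMonotone.exists_neg_mem {A : H → Set H} (hA : IsMaximallyMonotone A)
    (M : H ≃L[ℝ] H) (hM : ∀ x y, inner ℝ (M x) y = inner ℝ x (M y)) {c : ℝ} (hc : 0 < c)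
    (hco : ∀ x, c * ‖x‖ ^ 2 ≤ inner ℝ (M x) x) : ∃ x, -M x ∈ A x := by
  obtain ⟨d, hd, hdo⟩ := exists_coercive_symm M hc hco
  -- Pairing `M` with `M⁻¹` completes the square with the duality product, so the objective is
  -- bounded below by `0`.
  let B : (H × H) →L[ℝ] (H × H) →L[ℝ] ℝ :=
    (innerSL ℝ).bilinearComp ((M : H →L[ℝ] H).comp (.fst ℝ H H)) (.fst ℝ H H) +
      (innerSL ℝ).bilinearComp ((M.symm : H →L[ℝ] H).comp (.snd ℝ H H)) (.snd ℝ H H)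
  have hBval : ∀ v w, B v w = inner ℝ (M v.1) w.1 + inner ℝ (M.symm v.2) w.2 :=
    fun v w => rfl
  have hBsymm : ∀ v w, B v w = B w v := fun v w => by
    rw [hBval, hBval, hM, symm_apply_inner M hM, real_inner_comm, real_inner_comm v.2]
  have hBco : IsCoercive B := by
    refine ⟨min c d, lt_min hc hd, fun w => ?_⟩
    rw [hBval]
    have h1 := hco w.1
    have h2 := hdo w.2
    have h1' : 0 ≤ c * ‖w.1‖ ^ 2 := by positivity
    have h2' : 0 ≤ d * ‖w.2‖ ^ 2 := by positivity
    rcases le_total ‖w.1‖ ‖w.2‖ with h | h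
    · rw [Prod.norm_def, max_eq_right h]
      nlinarith [mul_le_mul_of_nonneg_right (min_le_right c d) (sq_nonneg ‖w.2‖)]
    · rw [Prod.norm_def, max_eq_left h]
      nlinarith [mul_le_mul_of_nonneg_right (min_le_left c d) (sq_nonneg ‖w.1‖)]
  -- `⟨M x, x⟩ + ⟨M⁻¹ u, u⟩ + 2 ⟨x, u⟩` is the quadratic form of `M` at `x + M⁻¹ u`
  have hsq : ∀ x u, inner ℝ (M (x + M.symm u)) (x + M.symm u) =
      B (x, u) (x, u) + 2 * inner ℝ x u := by
    intro x u
    rw [hBval, map_add, ContinuousLinearEquiv.apply_symm_apply, inner_add_left, inner_add_right,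
      inner_add_right, hM x (M.symm u), ContinuousLinearEquiv.apply_symm_apply,
      real_inner_comm x u, real_inner_comm u (M.symm u)]
    ring
  have hnn : ∀ x, 0 ≤ inner ℝ (M x) x := fun x => le_trans (by positivity) (hco x)
  obtain ⟨y₀, v₀, hv₀⟩ := hA.exists_mem
  obtain ⟨⟨⟨x, u⟩, t⟩, hw, hmin⟩ := exists_isMinOn_of_isCoercive B hBsymm hBco
    (convex_fitzpatrickEpigraph A) (isClosed_fitzpatrickEpigraph A)
    ⟨_, hA.1.mem_fitzpatrickEpigraph hv₀⟩ ⟨0, fun w hw => by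
      have h1 := hA.inner_le_of_mem_fitzpatrickEpigraph hw
      have h2 := hsq w.1.1 w.1.2
      have h3 := hnn (w.1.1 + M.symm w.1.2)
      simp only [Prod.mk.eta] at h2
      linarith⟩
  have ht : inner ℝ x u ≤ t := hA.inner_le_of_mem_fitzpatrickEpigraph hw
  -- Optimality makes `(-M⁻¹ u, -M x)` monotonically related to the graph, with the square of `x +
  -- M⁻¹ u` to spare. Maximality puts this pair in the graph; testing it against itself then forces
  -- `x = -M⁻¹ u`.
  have hmain : ∀ y v, v ∈ A y →
      inner ℝ (M (x + M.symm u)) (x + M.symm u) ≤ inner ℝ (-M.symm u - y) (-M x - v) := by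
    intro y v hv
    have h := variational_inequality_of_isMinOn B hBsymm (convex_fitzpatrickEpigraph A) hw hmin
      (hA.1.mem_fitzpatrickEpigraph hv)
    simp only [hBval (x, u) (y, v)] at h
    rw [hsq]
    have h1 : inner ℝ (M.symm u) (M x) = inner ℝ x u := by
      rw [symm_apply_inner M hM, ContinuousLinearEquiv.symm_apply_apply, real_inner_comm]
    simp only [inner_sub_left, inner_sub_right, inner_neg_left, inner_neg_right, h1]
    rw [real_inner_comm (M x) y]
    linarith
  have hmem : -M x ∈ A (-M.symm u) :=
    hA.2 _ _ fun y v hv => (hnn _).trans (hmain y v hv)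
  have h0 := (hco _).trans (hmain _ _ hmem)
  rw [sub_self, inner_zero_left] at h0
  have h1 : ‖x + M.symm u‖ ^ 2 = 0 :=
    le_antisymm (nonpos_of_mul_nonpos_right h0 hc) (by positivity)
  have h2 : x = -M.symm u := eq_neg_of_add_eq_zero_left (by simpa using h1)
  exact ⟨x, by rwa [← h2] at hmem⟩

/-- If `A` is maximally monotone and `S` is self-adjoint and coercive, then the resolvent of `S A`
is single-valued with full domain. -/
theorem IsMaximallyMonotone.hasResolvent_comp {A : H → Set H} (hA : IsMaximallyMonotone A)
    (S : H ≃L[ℝ] H) (hS : ∀ x y, inner ℝ (S x) y = inner ℝ x (S y)) {c : ℝ} (hc : 0 < c)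
    (hco : ∀ x, c * ‖x‖ ^ 2 ≤ inner ℝ (S x) x) : HasResolvent (comp S A) := by
  obtain ⟨d, hd, hdo⟩ := exists_coercive_symm S hc hco
  have hiff : ∀ x p, p ∈ setResolvent (comp S A) x ↔ S.symm (x - p) ∈ A p := by
    intro x p
    rw [mem_setResolvent, comp]
    constructor
    · rintro ⟨a, ha, h⟩
      rwa [← h, ContinuousLinearEquiv.symm_apply_apply]
    · exact fun h => ⟨_, h, S.apply_symm_apply _⟩
  intro x
  -- The condition `x - p ∈ S (A p)` says that `p` is a zero of `S⁻¹ + (A - S⁻¹ x)`, to which Minty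
  -- applies.
  obtain ⟨p, hp⟩ := (hA.sub_const (S.symm x)).exists_neg_mem S.symm (symm_apply_inner S hS) hd hdo
  have hpx : p ∈ setResolvent (comp S A) x := by
    rw [hiff, map_sub, sub_eq_neg_add]
    exact hp
  have hJ : J (comp S A) x ∈ setResolvent (comp S A) x := Classical.epsilon_spec ⟨p, hpx⟩
  refine Set.eq_singleton_iff_unique_mem.2 ⟨hJ, fun q hq => ?_⟩
  rw [hiff] at hJ hq
  have h := hA.1 _ _ _ _ hq hJ
  rw [← map_sub, sub_sub_sub_cancel_left, ← neg_sub q, map_neg, inner_neg_right,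
    real_inner_comm] at h
  have h1 := hdo (q - J (comp S A) x)
  have h2 : ‖q - J (comp S A) x‖ ^ 2 = 0 :=
    le_antisymm (nonpos_of_mul_nonpos_right (by linarith) hd) (by positivity)
  exact sub_eq_zero.1 (by simpa using h2)

/-- A strongly monotone bounded linear operator is a continuous linear equivalence. -/
theorem exists_equiv_of_coercive (T : H →L[ℝ] H) {c : ℝ} (hc : 0 < c)
    (hco : ∀ x, c * ‖x‖ ^ 2 ≤ inner ℝ (T x) x) : ∃ S : H ≃L[ℝ] H, (S : H →L[ℝ] H) = T := by
  -- Lax–Milgram for the form `⟨T ·, ·⟩`.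
  have h : IsCoercive ((innerSL ℝ).comp T) := ⟨c, hc, fun u => by
    rw [mul_assoc, ← sq]
    exact hco u⟩
  refine ⟨h.continuousLinearEquivOfBilin, ContinuousLinearMap.ext fun x => ?_⟩
  refine ext_inner_right ℝ fun y => ?_
  rw [ContinuousLinearEquiv.coe_coe, h.continuousLinearEquivOfBilin_apply]
  rfl

end Resolvent

/-! ### Moreau's decomposition and the Douglas–Rachford operator -/

section DouglasRachford

variable {H : Type*} [NormedAddCommGroup H] [InnerProductSpace ℝ H]

theorem HasResolvent.eq_J_iff {A : H → Set H} {S : H ≃L[ℝ] H} (h : HasResolvent (comp S A))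
    {x p : H} : p = J (comp S A) x ↔ S.symm (x - p) ∈ A p := by
  rw [← Set.mem_singleton_iff, ← h x, mem_setResolvent, comp]
  constructor
  · rintro ⟨a, ha, h⟩
    rwa [← h, ContinuousLinearEquiv.symm_apply_apply]
  · exact fun h => ⟨_, h, S.apply_symm_apply _⟩

theorem HasResolvent.J_mem {A : H → Set H} {S : H ≃L[ℝ] H} (h : HasResolvent (comp S A))
    (x : H) : S.symm (x - J (comp S A) x) ∈ A (J (comp S A) x) :=
  h.eq_J_iff.1 rfl

/-- **Moreau's decomposition** for a set-valued operator and its inverse. -/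
theorem J_comp_symm_inv {B : H → Set H} {S : H ≃L[ℝ] H} (h : HasResolvent (comp S B))
    (h' : HasResolvent (comp S.symm (inv B))) (w : H) :
    J (comp S.symm (inv B)) (S.symm w) = S.symm (w - J (comp S B) w) := by
  refine (h'.eq_J_iff.2 ?_).symm
  rw [← map_sub, sub_sub_cancel, ContinuousLinearEquiv.symm_symm,
    ContinuousLinearEquiv.apply_symm_apply]
  exact h.J_mem w

/-- The displacement of the Douglas--Rachford operator is firmly nonexpansive in the metric of
`S⁻¹`. -/
theorem douglasRachford_displacement_firm {A B : H → Set H} (hA : IsMonotone A)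
    (hB : IsMonotone B) (S : H ≃L[ℝ] H) (hS : ∀ x y, inner ℝ (S x) y = inner ℝ x (S y))
    (hJA : HasResolvent (comp S A)) (hJB : HasResolvent (comp S B)) (D : H → H)
    (hD : ∀ x, D x = x - douglasRachford (S : H →L[ℝ] H) B A x) (x y : H) :
    inner ℝ (S.symm (D x - D y)) (D x - D y) ≤ inner ℝ (S.symm (D x - D y)) (x - y) := by
  have hDJ : ∀ x, D x = J (comp S A) x -
      J (comp S B) ((2 : ℝ) • J (comp S A) x - x) := fun x => by
    rw [hD, douglasRachford]
    simp only [ContinuousLinearEquiv.coe_coe]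
    abel
  have h1 := hA _ _ _ _ (hJA.J_mem x) (hJA.J_mem y)
  have h2 := hB _ _ _ _ (hJB.J_mem ((2 : ℝ) • J (comp S A) x - x))
    (hJB.J_mem ((2 : ℝ) • J (comp S A) y - y))
  rw [hDJ, hDJ]
  generalize J (comp S B) ((2 : ℝ) • J (comp S A) x - x) = r at h2 ⊢
  generalize J (comp S B) ((2 : ℝ) • J (comp S A) y - y) = s at h2 ⊢
  generalize J (comp S A) x = p at h1 h2 ⊢
  generalize J (comp S A) y = q at h1 h2 ⊢
  rw [← map_sub] at h1 h2
  rw [← symm_apply_inner S hS] at h1 h2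
  have e1 : x - p - (y - q) = (x - y) - (p - q) := by abel
  have e2 : (2 : ℝ) • p - x - r - ((2 : ℝ) • q - y - s) =
      (2 : ℝ) • (p - q) - (x - y) - (r - s) := by
    rw [smul_sub]; abel
  have e3 : p - r - (q - s) = (p - q) - (r - s) := by abel
  rw [e1] at h1
  rw [e2] at h2
  rw [e3]
  generalize x - y = a at h1 h2 ⊢
  generalize p - q = b at h1 h2 ⊢
  generalize r - s = e at h1 h2 ⊢
  -- With the cross terms identified, the goal is exactly the sum of `h1` and `h2`.
  have hbe : inner ℝ (S.symm b) e = inner ℝ (S.symm e) b := by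
    rw [symm_apply_inner S hS, real_inner_comm]
  simp only [map_sub, inner_sub_left, inner_sub_right, inner_smul_right] at h1 h2 ⊢
  linarith

end DouglasRachford

end SetValuedOp

/-! ### The primal-dual iteration -/

theorem proposition3p4 {H : Type*} [NormedAddCommGroup H] [InnerProductSpace ℝ H] [CompleteSpace H]
    (A B : H → Set H)
    (hA : SetValuedOp.IsMaximallyMonotone A) (hB : SetValuedOp.IsMaximallyMonotone B)
    (hZ : (SetValuedOp.primalDualSolutions A B (ContinuousLinearMap.id ℝ H)).Nonempty)
    (Υ : H →L[ℝ] H) (hΥ_adj : IsSelfAdjoint Υ) (hΥ_mono : SetValuedOp.IsStronglyMonotone Υ)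
    (lam : ℕ → ℝ) (hlam : ∀ n, lam n ∈ Set.Icc (0 : ℝ) 2)
    (hlam_sum : Tendsto (fun N => ∑ n ∈ Finset.range N, lam n * (2 - lam n)) atTop atTop)
    (x u p q : ℕ → H)
    (hp : ∀ n, p (n + 1) = SetValuedOp.J (SetValuedOp.comp Υ A) (x n - Υ (u n)))
    (hq : ∀ n, q (n + 1) =
      SetValuedOp.J (SetValuedOp.comp Υ.inverse (SetValuedOp.inv B))
        (u n + Υ.inverse ((2 : ℝ) • p (n + 1) - x n)))
    (hx : ∀ n, x (n + 1) = (1 - lam n) • x n + lam n • p (n + 1))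
    (hu : ∀ n, u (n + 1) = (1 - lam n) • u n + lam n • q (n + 1))
    (z : ℕ → H) (hz : ∀ n, z n = x n - Υ (u n)) :
    -- the operators in the statement are well defined
    (Υ.IsInvertible ∧
      SetValuedOp.HasResolvent (SetValuedOp.comp Υ A) ∧
      SetValuedOp.HasResolvent (SetValuedOp.comp Υ B) ∧
      SetValuedOp.HasResolvent (SetValuedOp.comp Υ.inverse (SetValuedOp.inv B))) ∧
    -- the relaxed Douglas--Rachford recursion
    (∀ n, z (n + 1) = (1 - lam n) • z n + lam n • SetValuedOp.douglasRachford Υ B A (z n)) ∧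
    -- weak convergence to a fixed point whose primal-dual shadow is a solution
    ∃ zhat : H,
      Tendsto (fun n => toWeakSpace ℝ H (z n)) atTop (𝓝 (toWeakSpace ℝ H zhat)) ∧
      zhat ∈ Function.fixedPoints (SetValuedOp.douglasRachford Υ B A) ∧
      (SetValuedOp.J (SetValuedOp.comp Υ A) zhat,
          -Υ.inverse (zhat - SetValuedOp.J (SetValuedOp.comp Υ A) zhat)) ∈
        SetValuedOp.primalDualSolutions A B (ContinuousLinearMap.id ℝ H) := by
  obtain ⟨c, hc, hmono⟩ := hΥ_mono
  have hco : ∀ x, c * ‖x‖ ^ 2 ≤ inner ℝ (Υ x) x := fun x => by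
    simpa [real_inner_comm] using hmono x 0
  obtain ⟨S, rfl⟩ := SetValuedOp.exists_equiv_of_coercive Υ hc hco
  have hS : ∀ x y, inner ℝ (S x) y = inner ℝ x (S y) := fun x y => by
    have := ContinuousLinearMap.adjoint_inner_left (S : H →L[ℝ] H) y x
    rwa [hΥ_adj.adjoint_eq] at this
  obtain ⟨d, hd, hdo⟩ := SetValuedOp.exists_coercive_symm S hc hco
  have hJA := hA.hasResolvent_comp S hS hc hco
  have hJB := hB.hasResolvent_comp S hS hc hco
  have hJB' := hB.inv.hasResolvent_comp S.symm (SetValuedOp.symm_apply_inner S hS) hd hdo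
  have hG : ∀ z, SetValuedOp.douglasRachford (S : H →L[ℝ] H) B A z =
      SetValuedOp.J (SetValuedOp.comp S B)
        ((2 : ℝ) • SetValuedOp.J (SetValuedOp.comp S A) z - z) +
      (z - SetValuedOp.J (SetValuedOp.comp S A) z) := fun z => rfl
  simp only [ContinuousLinearMap.inverse_equiv, ContinuousLinearEquiv.coe_coe] at *
  have hrec : ∀ n, z (n + 1) = (1 - lam n) • z n +
      lam n • SetValuedOp.douglasRachford (S : H →L[ℝ] H) B A (z n) := by
    intro n
    -- The argument of the dual resolvent is `S⁻¹ (2p - z)`, so Moreau's decomposition applies.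
    have hSq : S (q (n + 1)) = ((2 : ℝ) • p (n + 1) - z n) -
        SetValuedOp.J (SetValuedOp.comp S B) ((2 : ℝ) • p (n + 1) - z n) := by
      have h1 : u n + S.symm ((2 : ℝ) • p (n + 1) - x n) =
          S.symm ((2 : ℝ) • p (n + 1) - z n) := by
        apply S.injective
        rw [map_add, ContinuousLinearEquiv.apply_symm_apply,
          ContinuousLinearEquiv.apply_symm_apply, hz]
        abel
      rw [hq, h1, SetValuedOp.J_comp_symm_inv hJB hJB', ContinuousLinearEquiv.apply_symm_apply]
    rw [hG, hz (n + 1), hx, hu, map_add, map_smul, map_smul, hSq, hz n, ← hp n]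
    module
  refine ⟨⟨⟨S, rfl⟩, hJA, hJB, hJB'⟩, hrec, ?_⟩
  obtain ⟨⟨a, b⟩, hab⟩ := hZ
  have hsol : ∀ a b : H, (a, b) ∈
      SetValuedOp.primalDualSolutions A B (ContinuousLinearMap.id ℝ H) ↔ -b ∈ A a ∧ b ∈ B a := by
    intro a b
    simp [SetValuedOp.primalDualSolutions, SetValuedOp.inv, ContinuousLinearMap.adjoint_id,
      sub_eq_zero]
  rw [hsol] at hab
  have hfix : SetValuedOp.douglasRachford (S : H →L[ℝ] H) B A (a - S b) = a - S b := by
    have h1 : a = SetValuedOp.J (SetValuedOp.comp S A) (a - S b) :=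
      hJA.eq_J_iff.2 (by simpa using hab.1)
    have h2 : a = SetValuedOp.J (SetValuedOp.comp S B) ((2 : ℝ) • a - (a - S b)) :=
      hJB.eq_J_iff.2 (by
        have e : (2 : ℝ) • a - (a - S b) - a = S b := by module
        rw [e, ContinuousLinearEquiv.symm_apply_apply]
        exact hab.2)
    rw [hG, ← h1, ← h2]
    abel
  obtain ⟨w, hw, hlim⟩ := SetValuedOp.exists_weak_limit_of_firmlyNonexpansive
    (S.symm : H →L[ℝ] H) (SetValuedOp.symm_apply_inner S hS) hd hdo
    (fun z => z - SetValuedOp.douglasRachford (S : H →L[ℝ] H) B A z)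
    (SetValuedOp.douglasRachford_displacement_firm hA.1 hB.1 S hS hJA hJB _ fun _ => rfl)
    ⟨a - S b, by rw [hfix, sub_self]⟩ hlam hlam_sum (z := z)
    (fun n => by rw [hrec n]; module)
  refine ⟨w, SetValuedOp.tendsto_toWeakSpace_of_tendsto_inner hlim, (sub_eq_zero.1 hw).symm, ?_⟩
  rw [hsol, neg_neg]
  refine ⟨hJA.J_mem w, ?_⟩
  -- At a fixed point both resolvents return the same point, whose two inclusions carry opposite
  -- dual vectors.
  have hw' : SetValuedOp.J (SetValuedOp.comp S A) w = SetValuedOp.J (SetValuedOp.comp S B)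
      ((2 : ℝ) • SetValuedOp.J (SetValuedOp.comp S A) w - w) := by
    rw [hG] at hw
    rw [← sub_eq_zero, ← hw]
    abel
  have h := hJB.eq_J_iff.1 hw'
  rw [← map_neg]
  convert h using 2
  module
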